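/- Let $M\subset\mathbb{R}^n$ be a compact embedded $C^2$ submanifold (without boundary, possibly nonconvex) with positive reach $\tau\in(0,\infty]$, where $$\tau=\sup\{r>0:\ \text{every } y\in\mathbb{R}^n \text{ with } \mathrm{dist}(y,M)<r \text{ has a unique } z\in M \text{ with } \|y-z\|=\mathrm{dist}(y,M)\}.$$ Let $A:\mathbb{R}^n\to\mathbb{R}^d$ be linear with maximal singular value $\sigma_{\max}$, and let $0<\mu\le L<\infty$ be such that $$\mu\|y_1-y_2\|\le\|Ay_1-Ay_2\|\le L\|y_1-y_2\|\qquad\text{for all } y_1,y_2\in M.$$ Define the set of admissible observations $$X=\Big\{x\in\mathbb{R}^d:\ x=Ay_*+\eta \text{ for some } y_*\in M \text{ and } \eta\in\mathbb{R}^d \text{ with } \|\eta\|<\frac{1}{80}\,\frac{\mu^5}{\sigma_{\max}^2L^2}\,\tau\Big\},$$ where the bound on $\|\eta\|$ is read as $+\infty$ if $\tau=\infty$ or $\sigma_{\max}=0$. Then there exists $\alpha>0$, independent of $x$, such that for every $x\in X$ the problem $$\min_{y\in\mathbb{R}^n}\ \tfrac12\|x-Ay\|^2+\tfrac{\alpha}{2}\,\mathrm{dist}^2(y,M)$$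 has a unique minimizer $\hat y(x)$. Moreover, for this $\alpha$, the solution map $x\mapsto\hat y(x)$ is locally Lipschitz continuous on $X$: every $x\in X$ has a neighborhood $U$ such that the map is Lipschitz on $U\cap X$. -/

import Mathlib

open Set Metric
open scoped ENNReal

noncomputable section

namespace ManifoldInverse

/-- `M ⊆ ℝⁿ` is an embedded `C²` submanifold (without boundary) of dimension `k`: around each of its
points there is a `C²` diffeomorphism `φ` between open subsets of `ℝⁿ` which flattens `M`, i.e. in the
coordinates `φ` the set `M` is given by the vanishing of the last `n - k` coordinates. -/
def IsC2Submanifold {n : ℕ} (k : ℕ) (M : Set (EuclideanSpace ℝ (Fin n))) : Prop :=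
  k ≤ n ∧ ∀ p ∈ M,
    ∃ φ : OpenPartialHomeomorph (EuclideanSpace ℝ (Fin n)) (EuclideanSpace ℝ (Fin n)),
      p ∈ φ.source ∧ ContDiffOn ℝ 2 φ φ.source ∧ ContDiffOn ℝ 2 φ.symm φ.target ∧
        ∀ x ∈ φ.source, (x ∈ M ↔ ∀ i : Fin n, k ≤ (i : ℕ) → φ x i = 0)

/-- The reach of `M`: the supremum (in `[0, ∞]`) of the radii `r > 0` such that every point at
distance less than `r` from `M` has a unique nearest point in `M`. -/
def reach {n : ℕ} (M : Set (EuclideanSpace ℝ (Fin n))) : ℝ≥0∞ :=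
  sSup {r : ℝ≥0∞ | 0 < r ∧ ∀ y : EuclideanSpace ℝ (Fin n), infEDist y M < r →
    ∃! z, z ∈ M ∧ edist y z = infEDist y M}

/-- `A` is `(μ, L)`-bi-Lipschitz when restricted to `M`. -/
def IsBiLipschitzOn {n d : ℕ} (A : EuclideanSpace ℝ (Fin n) →ₗ[ℝ] EuclideanSpace ℝ (Fin d))
    (M : Set (EuclideanSpace ℝ (Fin n))) (μ L : ℝ) : Prop :=
  ∀ y₁ ∈ M, ∀ y₂ ∈ M, μ * ‖y₁ - y₂‖ ≤ ‖A y₁ - A y₂‖ ∧ ‖A y₁ - A y₂‖ ≤ L * ‖y₁ - y₂‖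

/-- The maximal singular value of `A` (singular values are listed in decreasing order from index
`0` on). -/
def sigmaMax {n d : ℕ} (A : EuclideanSpace ℝ (Fin n) →ₗ[ℝ] EuclideanSpace ℝ (Fin d)) : ℝ :=
  A.singularValues 0

/-- The admissible observations: `x = A y⋆ + η` with `y⋆ ∈ M` and
`‖η‖ < μ⁵ / (80 σ_max² L²) · reach M`. The bound is computed in `[0, ∞]`: it is `∞` if the reach is
infinite or if `A = 0`. -/
def admissible {n d : ℕ} (A : EuclideanSpace ℝ (Fin n) →ₗ[ℝ] EuclideanSpace ℝ (Fin d))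
    (M : Set (EuclideanSpace ℝ (Fin n))) (μ L : ℝ) : Set (EuclideanSpace ℝ (Fin d)) :=
  {x | ∃ y ∈ M, ∃ η : EuclideanSpace ℝ (Fin d), x = A y + η ∧
    ENNReal.ofReal ‖η‖ <
      ENNReal.ofReal (μ ^ 5) / ENNReal.ofReal (80 * sigmaMax A ^ 2 * L ^ 2) * reach M}

/-- The objective `y ↦ ½ ‖x - A y‖² + (α/2) dist(y, M)²`. -/
def objective {n d : ℕ} (A : EuclideanSpace ℝ (Fin n) →ₗ[ℝ] EuclideanSpace ℝ (Fin d))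
    (M : Set (EuclideanSpace ℝ (Fin n))) (α : ℝ) (x : EuclideanSpace ℝ (Fin d))
    (y : EuclideanSpace ℝ (Fin n)) : ℝ :=
  1 / 2 * ‖x - A y‖ ^ 2 + α / 2 * infDist y M ^ 2

end ManifoldInverse

end

/-!
Two facts drive the proof.

*Proximal inequality.* If every point at distance at most `t` from the compact set `M` has a unique
nearest point, and `p ∈ M` is nearest to `y` with `‖y - p‖ ≤ t`, then
`2 t ⟪y - p, q - p⟫ ≤ ‖y - p‖ ‖q - p‖²` for all `q ∈ M` (`inner_sub_le_of_unique_nearest`). It says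
that the ray from `p` through `y` can be prolonged to length `t` with `p` still nearest. To see this,
note that the distance to `M` grows with slope one when moving away from a unique nearest point
(`exists_add_mul_le_infDist`); hence a maximizer of `z ↦ dist (z, M) - c ‖z - y‖` on a ball around
`y`, with `c < 1`, lies on its boundary, so that some point of the sphere of radius `s` around `y`
has distance at least `dist (y, M) + s` from `M` (`exists_dist_eq_add_le_infDist`). By the equality
case of the triangle inequality, that point lies on the ray.

*Optimality.* Let `y` minimize the objective for the observation `x`, let `p` be any nearest point to
`y` in `M`, and `v = y - p`. Replacing `dist (·, M)` by `‖· - p‖` gives a quadratic majorant that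
touches the objective at `y`, so `A* (A y - x) + α v = 0` (`inner_add_inner_eq_zero_of_isMinOn`) and
`α ‖v‖ ≤ σ ‖x - A y‖ ≤ σ ‖η‖` (`mul_norm_sub_le_of_isMinOn`).

For two minimizers, subtract the optimality conditions and test with `y₁ - y₂`. The proximal
inequality bounds `α ⟪v₁ - v₂, p₁ - p₂⟫` from below by `-(σ ‖η‖ / t) ‖p₁ - p₂‖²`, and the noise bound
makes this a small fraction of the gain `μ² ‖p₁ - p₂‖² / 2` from the bi-Lipschitz condition. So
`‖p₁ - p₂‖ + ‖v₁ - v₂‖`, and with it `‖y₁ - y₂‖`, is at most a constant times `‖x₁ - x₂‖`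
(`norm_sub_le_of_isMinOn`). Uniqueness is the case `x₁ = x₂`, and the solution map is even Lipschitz
on the whole set of admissible observations.
-/

open scoped RealInnerProductSpace NNReal

namespace ManifoldInverse

/-! ### The proximal inequality for sets with unique nearest points -/

section Proximal

variable {E : Type*} [NormedAddCommGroup E] [InnerProductSpace ℝ E] {M : Set E}

/-- Moving away from a unique nearest point, the distance to a compact set grows with slope
arbitrarily close to one. -/
theorem exists_add_mul_le_infDist (hM : IsCompact M) {z p : E} (hp : p ∈ M)
    (hzp : dist z p = infDist z M) (hd : 0 < infDist z M)
    (huniq : ∀ q ∈ M, dist z q = infDist z M → q = p) {c : ℝ} (hc : c < 1) :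
    ∃ δ > 0, ∀ h, 0 ≤ h → h ≤ δ →
      infDist z M + c * h ≤ infDist (z + h • ((infDist z M)⁻¹ • (z - p))) M := by
  set D := infDist z M with hD
  set u := D⁻¹ • (z - p) with hu
  have hnzp : ‖z - p‖ = D := by rw [← dist_eq_norm, hzp]
  have hunorm : ‖u‖ = 1 := by
    rw [hu, norm_smul, hnzp, norm_inv, Real.norm_of_nonneg hd.le, inv_mul_cancel₀ hd.ne']
  -- The points of `M` seen from `z` in roughly the direction `-u`; the others, in `W`, are
  -- uniformly farther away than `p`.
  let W : Set E := M ∩ {q | ⟪u, z - q⟫ ≤ c * ‖z - q‖}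
  have hW : IsCompact W :=
    hM.inter_right (isClosed_le (by fun_prop) (by fun_prop))
  have hpW : p ∉ W := by
    rintro ⟨-, h⟩
    have h' : ⟪u, z - p⟫ ≤ c * ‖z - p‖ := h
    rw [hu, real_inner_smul_left, real_inner_self_eq_norm_sq, hnzp] at h'
    field_simp at h'
    nlinarith
  have hgap : ∃ ε > 0, ∀ q ∈ W, D + ε ≤ dist z q := by
    rcases W.eq_empty_or_nonempty with h | h
    · exact ⟨1, one_pos, by simp [h]⟩
    · obtain ⟨q₀, hq₀, hmin⟩ := hW.exists_isMinOn h (f := fun q => dist z q) (by fun_prop)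
      have h1 : D ≤ dist z q₀ := infDist_le_dist_of_mem hq₀.1
      have h2 : D ≠ dist z q₀ := fun h => hpW (huniq q₀ hq₀.1 h.symm ▸ hq₀)
      refine ⟨dist z q₀ - D, sub_pos.2 (lt_of_le_of_ne h1 h2), fun q hq => ?_⟩
      have : dist z q₀ ≤ dist z q := hmin hq
      linarith
  obtain ⟨ε, hε, hfar⟩ := hgap
  refine ⟨ε / 2, by positivity, fun h h0 hh => ?_⟩
  rw [le_infDist ⟨p, hp⟩]
  intro q hq
  rw [dist_eq_norm]
  have hDq : D ≤ ‖z - q‖ := by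
    rw [← dist_eq_norm]
    exact infDist_le_dist_of_mem hq
  have heq : z + h • u - q = (z - q) + h • u := by abel
  rw [heq]
  by_cases hqW : ⟪u, z - q⟫ ≤ c * ‖z - q‖
  · have h1 := hfar q ⟨hq, hqW⟩
    rw [dist_eq_norm] at h1
    have h2 : ‖z - q‖ ≤ ‖(z - q) + h • u‖ + ‖h • u‖ := by
      simpa using norm_sub_le ((z - q) + h • u) (h • u)
    rw [norm_smul, hunorm, Real.norm_of_nonneg h0] at h2
    nlinarith
  · push Not at hqW
    have h1 := real_inner_le_norm ((z - q) + h • u) (z - q)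
    rw [inner_add_left, real_inner_smul_left, real_inner_self_eq_norm_sq] at h1
    have hpos : 0 < ‖z - q‖ := hd.trans_le hDq
    have h2 : (‖z - q‖ + c * h) * ‖z - q‖ ≤ ‖(z - q) + h • u‖ * ‖z - q‖ := by nlinarith
    have h3 := le_of_mul_le_mul_right h2 hpos
    linarith

variable [ProperSpace E]

/-- As long as nearest points are unique, the sphere of radius `s` around `y` has a point whose
distance to `M` exceeds that of `y` by at least `s`. -/
theorem exists_dist_eq_add_le_infDist (hM : IsCompact M) {t : ℝ}
    (huniq : ∀ y, infDist y M ≤ t → ∃! z, z ∈ M ∧ dist y z = infDist y M) {y : E}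
    (hy : 0 < infDist y M) {s : ℝ} (hs : 0 ≤ s) (hst : infDist y M + s ≤ t) :
    ∃ z, dist z y = s ∧ infDist y M + s ≤ infDist z M := by
  have hcont : Continuous fun z => infDist z M := continuous_infDist_pt M
  have hslope : ∀ c, 0 ≤ c → c < 1 → ∃ z ∈ sphere y s, infDist y M + c * s ≤ infDist z M := by
    intro c hc0 hc
    obtain ⟨z, hz, hmax⟩ := (isCompact_closedBall y s).exists_isMaxOn ⟨y, mem_closedBall_self hs⟩
      (f := fun z => infDist z M - c * dist z y) (by fun_prop)
    have hzy : infDist y M ≤ infDist z M - c * dist z y := by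
      simpa using hmax (mem_closedBall_self hs)
    have hzs : dist z y ≤ s := hz
    have hsph : dist z y = s := by
      -- At a maximizer inside the ball, moving away from the nearest point would gain
      -- more distance to `M` than the penalty takes back.
      by_contra hlt
      replace hlt : dist z y < s := lt_of_le_of_ne hzs hlt
      have hzpos : 0 < infDist z M := by
        have := mul_nonneg hc0 (dist_nonneg (x := z) (y := y))
        linarith
      have hzt : infDist z M ≤ t := by
        have := infDist_le_infDist_add_dist (s := M) (x := z) (y := y)
        linarith
      obtain ⟨p, ⟨hp, hzp⟩, hpu⟩ := huniq z hzt
      obtain ⟨δ, hδ, hgrow⟩ := exists_add_mul_le_infDist hM hp hzp hzpos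
        (fun q hq h => hpu q ⟨hq, h⟩) (c := (1 + c) / 2) (by linarith)
      set h := min δ (s - dist z y) with hh
      have hpos : 0 < h := lt_min hδ (by linarith)
      have h1 := hgrow h hpos.le (min_le_left _ _)
      set w := z + h • ((infDist z M)⁻¹ • (z - p)) with hw
      have hwz : dist w z = h := by
        rw [dist_eq_norm, hw, add_sub_cancel_left, norm_smul, norm_smul, ← dist_eq_norm, hzp,
          norm_inv, Real.norm_of_nonneg hzpos.le, inv_mul_cancel₀ hzpos.ne',
          Real.norm_of_nonneg hpos.le, mul_one]
      have hwy : dist w y ≤ h + dist z y := hwz ▸ dist_triangle w z y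
      have hwb : w ∈ closedBall y s := by
        have := min_le_right δ (s - dist z y)
        rw [mem_closedBall]
        linarith
      have h2 : infDist w M - c * dist w y ≤ infDist z M - c * dist z y := hmax hwb
      nlinarith
    exact ⟨z, hsph, by rw [hsph] at hzy; linarith⟩
  obtain ⟨z₀, hz₀, -⟩ := hslope 0 le_rfl one_pos
  obtain ⟨z, hz, hmax⟩ := (isCompact_sphere y s).exists_isMaxOn ⟨z₀, hz₀⟩
    (f := fun z => infDist z M) hcont.continuousOn
  refine ⟨z, hz, le_of_forall_pos_lt_add fun ε hε => ?_⟩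
  -- The slope `c = s / (s + ε)` loses less than `ε` over the length `s`.
  obtain ⟨w, hw, hwle⟩ := hslope (s / (s + ε)) (by positivity)
    ((div_lt_one (by positivity)).2 (by linarith))
  have h1 : infDist w M ≤ infDist z M := hmax hw
  have h2 : s - ε < s / (s + ε) * s := by
    rw [div_mul_eq_mul_div, lt_div_iff₀ (by positivity)]
    nlinarith
  linarith

/-- The proximal inequality: a vector pointing from `p ∈ M` to a point that has `p` as nearest point
satisfies the outer ball condition of radius `t`. -/
theorem inner_sub_le_of_unique_nearest (hM : IsCompact M) {t : ℝ}
    (huniq : ∀ y, infDist y M ≤ t → ∃! z, z ∈ M ∧ dist y z = infDist y M) {y p q : E}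
    (hp : p ∈ M) (hyp : dist y p = infDist y M) (hyt : infDist y M ≤ t) (hq : q ∈ M) :
    2 * t * ⟪y - p, q - p⟫ ≤ ‖y - p‖ * ‖q - p‖ ^ 2 := by
  have hnorm : ‖y - p‖ = infDist y M := by rw [← dist_eq_norm, hyp]
  rcases (infDist_nonneg (x := y) (s := M)).eq_or_lt with h0 | hpos
  · have : y - p = 0 := by rw [← norm_eq_zero, hnorm, ← h0]
    simp [this]
  set D := infDist y M with hD
  obtain ⟨z, hzy, hz⟩ := exists_dist_eq_add_le_infDist hM huniq hpos
    (s := t - D) (by linarith) (by linarith)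
  rw [← hD] at hz
  have hzp : infDist z M ≤ ‖z - p‖ := by
    rw [← dist_eq_norm]
    exact infDist_le_dist_of_mem hp
  have hzq : infDist z M ≤ ‖z - q‖ := by
    rw [← dist_eq_norm]
    exact infDist_le_dist_of_mem hq
  have hzyn : ‖z - y‖ = t - D := by rw [← dist_eq_norm, hzy]
  have htri : ‖(z - y) + (y - p)‖ = ‖z - y‖ + ‖y - p‖ := by
    refine le_antisymm (norm_add_le _ _) ?_
    rw [sub_add_sub_cancel]
    linarith
  have hray : D • (z - y) = (t - D) • (y - p) := by
    have h := (sameRay_iff_norm_add.2 htri).norm_smul_eq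
    rw [hzyn, hnorm] at h
    exact h.symm
  have hzq' : D • (z - q) = t • (y - p) - D • (q - p) := by
    calc D • (z - q) = D • (z - y) + D • (y - p) - D • (q - p) := by module
      _ = _ := by rw [hray]; module
  have h1 : ‖t • (y - p) - D • (q - p)‖ = D * ‖z - q‖ := by
    rw [← hzq', norm_smul, Real.norm_of_nonneg hpos.le]
  have h2 := norm_sub_sq_real (t • (y - p)) (D • (q - p))
  rw [h1, norm_smul, norm_smul, real_inner_smul_left, real_inner_smul_right, mul_pow, mul_pow,
    mul_pow, hnorm, Real.norm_eq_abs, Real.norm_eq_abs, sq_abs, sq_abs] at h2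
  have htz : t ≤ ‖z - q‖ := by linarith
  have h3 : t ^ 2 ≤ ‖z - q‖ ^ 2 := pow_le_pow_left₀ (hpos.le.trans hyt) htz 2
  rw [hnorm]
  have h4 : D * (2 * t * ⟪y - p, q - p⟫) ≤ D * (D * ‖q - p‖ ^ 2) := by nlinarith
  exact le_of_mul_le_mul_left h4 hpos

end Proximal

/-! ### The reach, the largest singular value and the noise bound -/

variable {n d : ℕ} {M : Set (EuclideanSpace ℝ (Fin n))}
  {A : EuclideanSpace ℝ (Fin n) →ₗ[ℝ] EuclideanSpace ℝ (Fin d)}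

theorem existsUnique_nearest_of_lt_reach (hne : M.Nonempty) {t : ℝ≥0} (ht : (t : ℝ≥0∞) < reach M)
    (y : EuclideanSpace ℝ (Fin n)) (hy : infDist y M ≤ t) :
    ∃! z, z ∈ M ∧ dist y z = infDist y M := by
  obtain ⟨r, ⟨-, hr⟩, htr⟩ := lt_sSup_iff.1 ht
  have hfin : infEDist y M ≠ ⊤ := infEDist_ne_top hne
  have hlt : infEDist y M < r := by
    refine lt_of_le_of_lt ?_ htr
    rw [← ENNReal.ofReal_toReal hfin, ← ENNReal.ofReal_coe_nnreal]
    exact ENNReal.ofReal_le_ofReal hy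
  have hiff : ∀ z, edist y z = infEDist y M ↔ dist y z = infDist y M := fun z => by
    rw [dist_edist, infDist, ENNReal.toReal_eq_toReal_iff' (edist_ne_top _ _) hfin]
  simpa only [hiff] using hr y hlt

theorem sigmaMax_nonneg : 0 ≤ sigmaMax A := A.singularValues_nonneg 0

theorem norm_apply_le_sigmaMax (v : EuclideanSpace ℝ (Fin n)) : ‖A v‖ ≤ sigmaMax A * ‖v‖ := by
  refine le_of_sq_le_sq ?_ (mul_nonneg sigmaMax_nonneg (norm_nonneg v))
  have hn : Module.finrank ℝ (EuclideanSpace ℝ (Fin n)) = n := finrank_euclideanSpace_fin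
  let hT := A.isSymmetric_adjoint_comp_self
  let b := hT.eigenvectorBasis hn
  have h1 : ‖A v‖ ^ 2 = ∑ i, hT.eigenvalues hn i * ⟪b i, v⟫ ^ 2 := by
    rw [← real_inner_self_eq_norm_sq, ← LinearMap.adjoint_inner_right, ← b.sum_inner_mul_inner]
    refine Finset.sum_congr rfl fun i _ => ?_
    have h2 : ⟪b i, (LinearMap.adjoint A ∘ₗ A) v⟫ = hT.eigenvalues hn i * ⟪b i, v⟫ := by
      rw [← hT, hT.apply_eigenvectorBasis]
      exact real_inner_smul_left _ _ _
    have h3 : ⟪b i, LinearMap.adjoint A (A v)⟫ = hT.eigenvalues hn i * ⟪b i, v⟫ := h2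
    rw [h3, real_inner_comm]
    ring
  rw [h1, mul_pow, ← b.sum_sq_inner_right v, Finset.mul_sum]
  refine Finset.sum_le_sum fun i _ => mul_le_mul_of_nonneg_right ?_ (sq_nonneg _)
  rw [← A.sq_singularValues_fin hn i]
  exact pow_le_pow_left₀ (A.singularValues_nonneg _) (A.singularValues_antitone (Nat.zero_le _)) 2

/-- The factor `μ⁵ / (80 σ L²)`, which is `σ` times the one in the noise bound. For `σ = 0` the value
`0` given by division by zero is the right one: then `σ ‖η‖ = 0` whatever the noise. -/
noncomputable def noiseFactor (A : EuclideanSpace ℝ (Fin n) →ₗ[ℝ] EuclideanSpace ℝ (Fin d)) (μ L : ℝ) : ℝ :=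
  μ ^ 5 / (80 * sigmaMax A * L ^ 2)

theorem noiseFactor_nonneg {μ L : ℝ} (hμ : 0 < μ) : 0 ≤ noiseFactor A μ L := by
  have := sigmaMax_nonneg (A := A)
  unfold noiseFactor
  positivity

/-- Two distinct points of `M` force `μ ≤ σ`, which makes the noise factor small against `μ²`. -/
theorem noiseFactor_mul_sq_le {μ L : ℝ} (hμ : 0 < μ) (hμL : μ ≤ L) (hA : IsBiLipschitzOn A M μ L)
    {p q : EuclideanSpace ℝ (Fin n)} (hp : p ∈ M) (hq : q ∈ M) :
    noiseFactor A μ L * ‖p - q‖ ^ 2 ≤ μ ^ 2 / 4 * ‖p - q‖ ^ 2 := by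
  rcases (norm_nonneg (p - q)).eq_or_lt with h | h
  · simp [← h]
  have hμσ : μ ≤ sigmaMax A := by
    refine le_of_mul_le_mul_right ((hA p hp q hq).1.trans ?_) h
    rw [← map_sub]
    exact norm_apply_le_sigmaMax _
  refine mul_le_mul_of_nonneg_right ?_ (sq_nonneg _)
  have hσ : 0 < sigmaMax A := hμ.trans_le hμσ
  have hL : 0 < L := hμ.trans_le hμL
  rw [noiseFactor, div_le_iff₀ (by positivity)]
  calc μ ^ 5 = μ ^ 2 * (μ * μ ^ 2) := by ring
    _ ≤ μ ^ 2 * (sigmaMax A * L ^ 2) := by gcongr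
    _ ≤ μ ^ 2 / 4 * (80 * sigmaMax A * L ^ 2) := by
      have : 0 ≤ μ ^ 2 * (sigmaMax A * L ^ 2) := by positivity
      linarith

/-- An admissible observation has its noise bounded in terms of some finite radius `t < reach M`.
The bound persists for larger `t`. -/
theorem exists_radius_of_mem_admissible {μ L : ℝ} (hμ : 0 < μ) (hμL : μ ≤ L)
    (hreach : 0 < reach M) {x : EuclideanSpace ℝ (Fin d)} (hx : x ∈ admissible A M μ L) :
    ∃ y ∈ M, ∃ t : ℝ≥0, 0 < t ∧ (t : ℝ≥0∞) < reach M ∧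
      sigmaMax A * ‖x - A y‖ ≤ noiseFactor A μ L * t := by
  obtain ⟨y, hy, η, rfl, hη⟩ := hx
  refine ⟨y, hy, ?_⟩
  rw [add_sub_cancel_left]
  have hL : 0 < L := hμ.trans_le hμL
  rcases (sigmaMax_nonneg (A := A)).eq_or_lt with hσ | hσ
  · obtain ⟨t, ht0, ht⟩ := ENNReal.lt_iff_exists_nnreal_btwn.1 hreach
    refine ⟨t, by exact_mod_cast ht0, ht, ?_⟩
    rw [← hσ, zero_mul]
    exact mul_nonneg (noiseFactor_nonneg hμ) t.coe_nonneg
  · set c := μ ^ 5 / (80 * sigmaMax A ^ 2 * L ^ 2) with hc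
    have hcpos : 0 < c := by positivity
    rw [← ENNReal.ofReal_div_of_pos (by positivity), ← hc, mul_comm,
      ← ENNReal.div_lt_iff (Or.inl (ENNReal.ofReal_pos.2 hcpos).ne')
        (Or.inl ENNReal.ofReal_ne_top), ← ENNReal.ofReal_div_of_pos hcpos] at hη
    obtain ⟨t, ht0, ht⟩ := ENNReal.lt_iff_exists_nnreal_btwn.1 hη
    rw [← ENNReal.ofReal_coe_nnreal,
      ENNReal.ofReal_lt_ofReal_iff_of_nonneg (by positivity)] at ht0
    refine ⟨t, ?_, ht, ?_⟩
    · have h0 : (0 : ℝ) < t := lt_of_le_of_lt (by positivity) ht0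
      exact_mod_cast h0
    · have h1 : ‖η‖ ≤ t * c := ((div_lt_iff₀ hcpos).1 ht0).le
      have h2 : noiseFactor A μ L = sigmaMax A * c := by
        rw [hc, noiseFactor]
        field_simp
      rw [h2]
      nlinarith

/-! ### Existence of minimizers and the optimality condition -/

theorem exists_isMinOn_objective (hM : IsCompact M) (hne : M.Nonempty) {α : ℝ} (hα : 0 < α)
    (x : EuclideanSpace ℝ (Fin d)) : ∃ y, IsMinOn (objective A M α x) univ y := by
  have hAc : Continuous A := A.continuous_of_finiteDimensional
  have hcont : Continuous (objective A M α x) := by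
    unfold objective
    have := continuous_infDist_pt M
    fun_prop
  obtain ⟨p, hp⟩ := hne
  -- Outside a large ball around `p`, the distance term alone exceeds the value at `p`.
  obtain ⟨R, hR⟩ := hM.isBounded.subset_closedBall p
  obtain ⟨S, hS0, hS⟩ : ∃ S, 0 ≤ S ∧ objective A M α x p ≤ α / 2 * S ^ 2 := by
    refine ⟨√(2 / α * objective A M α x p), Real.sqrt_nonneg _, ?_⟩
    rw [Real.sq_sqrt (by unfold objective; positivity)]
    field_simp
    rfl
  have hR0 : 0 ≤ R := dist_nonneg.trans (mem_closedBall.1 (hR hp))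
  obtain ⟨y, -, hy⟩ := (isCompact_closedBall p (R + S)).exists_isMinOn
    ⟨p, mem_closedBall_self (by positivity)⟩ hcont.continuousOn
  refine ⟨y, fun z _ => ?_⟩
  by_cases hz : z ∈ closedBall p (R + S)
  · exact hy hz
  · have h1 : objective A M α x y ≤ objective A M α x p := hy (mem_closedBall_self (by positivity))
    have h2 : S ≤ infDist z M := by
      rw [le_infDist ⟨p, hp⟩]
      intro q hq
      have h3 := dist_triangle z q p
      have h4 := mem_closedBall.1 (hR hq)
      rw [mem_closedBall] at hz
      linarith
    have h3 : S ^ 2 ≤ infDist z M ^ 2 := pow_le_pow_left₀ hS0 h2 2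
    have h4 : α / 2 * infDist z M ^ 2 ≤ objective A M α x z := by
      unfold objective
      have := sq_nonneg ‖x - A z‖
      linarith
    have h5 : α / 2 * S ^ 2 ≤ α / 2 * infDist z M ^ 2 := by gcongr
    exact h1.trans (hS.trans (h5.trans h4))

/-- The optimality condition `A* (A y - x) + α (y - p) = 0` in weak form, for any nearest point `p`
of a minimizer `y`. It needs no differentiability of the distance function, since
`½ ‖x - A ·‖² + (α / 2) ‖· - p‖²` is a majorant of the objective that touches it at `y`. -/
theorem inner_add_inner_eq_zero_of_isMinOn {α : ℝ} (hα : 0 < α) {x : EuclideanSpace ℝ (Fin d)}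
    {y p : EuclideanSpace ℝ (Fin n)} (hy : IsMinOn (objective A M α x) univ y) (hp : p ∈ M)
    (hyp : dist y p = infDist y M) (w : EuclideanSpace ℝ (Fin n)) :
    ⟪A y - x, A w⟫ + α * ⟪y - p, w⟫ = 0 := by
  set g := ⟪A y - x, A w⟫ + α * ⟪y - p, w⟫ with hg
  set Q := ‖A w‖ ^ 2 + α * ‖w‖ ^ 2 with hQ
  have hQ0 : 0 ≤ Q := by positivity
  have hquad : ∀ s : ℝ, 0 ≤ s * g + s ^ 2 * (Q / 2) := by
    intro s
    have h1 : objective A M α x y ≤ objective A M α x (y + s • w) := hy (mem_univ _)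
    have h2 : infDist (y + s • w) M ^ 2 ≤ ‖(y - p) + s • w‖ ^ 2 := by
      refine pow_le_pow_left₀ infDist_nonneg ?_ 2
      rw [sub_add_eq_add_sub, ← dist_eq_norm]
      exact infDist_le_dist_of_mem hp
    have h3 : x - A (y + s • w) = -((A y - x) + s • A w) := by
      rw [map_add, map_smul]
      abel
    unfold objective at h1
    rw [h3, norm_neg, norm_sub_rev x, ← hyp, dist_eq_norm, norm_add_sq_real (A y - x),
      real_inner_smul_right, norm_smul, mul_pow, Real.norm_eq_abs, sq_abs] at h1
    rw [norm_add_sq_real, real_inner_smul_right, norm_smul, mul_pow, Real.norm_eq_abs,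
      sq_abs] at h2
    have h4 := mul_le_mul_of_nonneg_left h2 (half_pos hα).le
    rw [hg, hQ]
    linarith
  -- Evaluate at the minimum of a slightly steeper parabola.
  have h := hquad (-g / (Q + 1))
  have h' : 0 ≤ -(g ^ 2 * (Q / 2 + 1)) / (Q + 1) ^ 2 := by
    refine h.trans_eq ?_
    field_simp
    ring
  have h'' : 0 ≤ -(g ^ 2 * (Q / 2 + 1)) := by
    by_contra hneg
    exact absurd h' (not_le.2 (div_neg_of_neg_of_pos (not_le.1 hneg) (by positivity)))
  have : g ^ 2 ≤ 0 := by nlinarith [sq_nonneg g]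
  exact pow_eq_zero_iff two_ne_zero |>.1 (le_antisymm this (sq_nonneg g))

theorem mul_norm_sub_le_of_isMinOn {α : ℝ} (hα : 0 < α) {x : EuclideanSpace ℝ (Fin d)}
    {y p m : EuclideanSpace ℝ (Fin n)} (hy : IsMinOn (objective A M α x) univ y) (hp : p ∈ M)
    (hyp : dist y p = infDist y M) (hm : m ∈ M) :
    α * ‖y - p‖ ≤ sigmaMax A * ‖x - A m‖ := by
  have hfit : ‖x - A y‖ ≤ ‖x - A m‖ := by
    have h : objective A M α x y ≤ objective A M α x m := hy (mem_univ _)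
    unfold objective at h
    rw [infDist_zero_of_mem hm] at h
    have : 0 ≤ α / 2 * infDist y M ^ 2 := by positivity
    refine le_of_sq_le_sq ?_ (norm_nonneg _)
    linarith
  have h1 := inner_add_inner_eq_zero_of_isMinOn hα hy hp hyp (y - p)
  rw [real_inner_self_eq_norm_sq] at h1
  have h2 : -(‖A y - x‖ * ‖A (y - p)‖) ≤ ⟪A y - x, A (y - p)⟫ :=
    (abs_le.1 (abs_real_inner_le_norm _ _)).1
  rw [norm_sub_rev] at h2
  have h3 : ‖x - A y‖ * ‖A (y - p)‖ ≤ ‖x - A m‖ * (sigmaMax A * ‖y - p‖) :=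
    mul_le_mul hfit (norm_apply_le_sigmaMax _) (norm_nonneg _) (norm_nonneg _)
  rcases (norm_nonneg (y - p)).eq_or_lt with h0 | h0
  · rw [← h0, mul_zero]
    exact mul_nonneg sigmaMax_nonneg (norm_nonneg _)
  · refine le_of_mul_le_mul_right ?_ h0
    nlinarith

/-! ### Stability of minimizers -/

theorem min_mul_add_le {k l a b r : ℝ} (hk : 0 < k) (hl : 0 < l) (ha : 0 ≤ a) (hb : 0 ≤ b)
    (hr : 0 ≤ r) (h : k * a ^ 2 + l * b ^ 2 ≤ r * (a + b)) : min k l * (a + b) ≤ 2 * r := by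
  have hκ : 0 < min k l := lt_min hk hl
  have h1 : min k l * a ^ 2 ≤ k * a ^ 2 :=
    mul_le_mul_of_nonneg_right (min_le_left _ _) (sq_nonneg _)
  have h2 : min k l * b ^ 2 ≤ l * b ^ 2 :=
    mul_le_mul_of_nonneg_right (min_le_right _ _) (sq_nonneg _)
  have h3 := mul_nonneg hκ.le (sq_nonneg (a - b))
  rcases (add_nonneg ha hb).eq_or_lt with h0 | h0
  · rw [← h0, mul_zero]
    positivity
  · refine le_of_mul_le_mul_right ?_ h0
    linarith

/-- Minimizers depend on the observation in a Lipschitz way. The weight `α` exceeds `σ²` by at least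
one, and exceeds the noise factor so that minimizers stay within the reach of `M`. -/
theorem norm_sub_le_of_isMinOn (hM : IsCompact M) (hreach : 0 < reach M) {μ L : ℝ} (hμ : 0 < μ)
    (hμL : μ ≤ L) (hA : IsBiLipschitzOn A M μ L) {α : ℝ}
    (hα : α = sigmaMax A ^ 2 + noiseFactor A μ L + 1)
    {x₁ x₂ : EuclideanSpace ℝ (Fin d)} (hx₁ : x₁ ∈ admissible A M μ L)
    (hx₂ : x₂ ∈ admissible A M μ L) {y₁ y₂ : EuclideanSpace ℝ (Fin n)}
    (hy₁ : IsMinOn (objective A M α x₁) univ y₁) (hy₂ : IsMinOn (objective A M α x₂) univ y₂) :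
    ‖y₁ - y₂‖ ≤ 2 * sigmaMax A / min (μ ^ 2 / 4) 1 * ‖x₁ - x₂‖ := by
  set σ := sigmaMax A
  set K := noiseFactor A μ L
  have hσ : 0 ≤ σ := sigmaMax_nonneg
  have hK0 : 0 ≤ K := noiseFactor_nonneg hμ
  have hα0 : 0 < α := by rw [hα]; positivity
  have hKα : K ≤ α := by rw [hα]; nlinarith
  obtain ⟨m₁, hm₁, t₁, ht₁, hr₁, hb₁⟩ := exists_radius_of_mem_admissible hμ hμL hreach hx₁
  obtain ⟨m₂, hm₂, t₂, ht₂, hr₂, hb₂⟩ := exists_radius_of_mem_admissible hμ hμL hreach hx₂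
  have hne : M.Nonempty := ⟨m₁, hm₁⟩
  -- A common radius for both observations.
  set t := max t₁ t₂ with ht
  have htr : (t : ℝ≥0∞) < reach M := by
    rw [ht, ENNReal.coe_max]
    exact max_lt hr₁ hr₂
  have ht0 : (0 : ℝ) < t := by exact_mod_cast lt_max_of_lt_left ht₁
  have h1t : (t₁ : ℝ) ≤ t := by exact_mod_cast le_max_left t₁ t₂
  have h2t : (t₂ : ℝ) ≤ t := by exact_mod_cast le_max_right t₁ t₂
  have huniq := existsUnique_nearest_of_lt_reach hne htr
  obtain ⟨p₁, hp₁, hyp₁⟩ := hM.exists_infDist_eq_dist hne y₁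
  obtain ⟨p₂, hp₂, hyp₂⟩ := hM.exists_infDist_eq_dist hne y₂
  have hv₁ : α * ‖y₁ - p₁‖ ≤ K * t :=
    ((mul_norm_sub_le_of_isMinOn hα0 hy₁ hp₁ hyp₁.symm hm₁).trans hb₁).trans
      (mul_le_mul_of_nonneg_left h1t hK0)
  have hv₂ : α * ‖y₂ - p₂‖ ≤ K * t :=
    ((mul_norm_sub_le_of_isMinOn hα0 hy₂ hp₂ hyp₂.symm hm₂).trans hb₂).trans
      (mul_le_mul_of_nonneg_left h2t hK0)
  -- The proximal inequality, scaled by `α`.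
  have hprox : ∀ {y p q : EuclideanSpace ℝ (Fin n)}, p ∈ M → q ∈ M → infDist y M = dist y p →
      α * ‖y - p‖ ≤ K * t → α * ⟪y - p, q - p⟫ ≤ K / 2 * ‖q - p‖ ^ 2 := by
    intro y p q hp hq hyp hv
    have hle : infDist y M ≤ t := by
      rw [hyp, dist_eq_norm]
      refine le_of_mul_le_mul_left (hv.trans ?_) hα0
      exact mul_le_mul_of_nonneg_right hKα ht0.le
    have h1 := inner_sub_le_of_unique_nearest hM huniq hp hyp.symm hle hq
    have h2 : α * (2 * t * ⟪y - p, q - p⟫) ≤ K * t * ‖q - p‖ ^ 2 := by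
      refine (mul_le_mul_of_nonneg_left h1 hα0.le).trans ?_
      rw [← mul_assoc]
      exact mul_le_mul_of_nonneg_right hv (sq_nonneg _)
    have h3 : (2 * t : ℝ) * (α * ⟪y - p, q - p⟫) ≤ 2 * t * (K / 2 * ‖q - p‖ ^ 2) := by linarith
    exact le_of_mul_le_mul_left h3 (by positivity)
  have hq₁ := hprox hp₁ hp₂ hyp₁ hv₁
  have hq₂ := hprox hp₂ hp₁ hyp₂ hv₂
  have ho₁ := inner_add_inner_eq_zero_of_isMinOn hα0 hy₁ hp₁ hyp₁.symm (y₁ - y₂)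
  have ho₂ := inner_add_inner_eq_zero_of_isMinOn hα0 hy₂ hp₂ hyp₂.symm (y₁ - y₂)
  obtain ⟨v₁, hv₁'⟩ : ∃ v, v = y₁ - p₁ := ⟨_, rfl⟩
  obtain ⟨v₂, hv₂'⟩ : ∃ v, v = y₂ - p₂ := ⟨_, rfl⟩
  rw [← hv₁'] at hq₁ ho₁
  rw [← hv₂'] at hq₂ ho₂
  have hy : y₁ - y₂ = (p₁ - p₂) + (v₁ - v₂) := by rw [hv₁', hv₂']; abel
  set a := ‖p₁ - p₂‖ with ha
  set b := ‖v₁ - v₂‖ with hb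
  have hyab : ‖y₁ - y₂‖ ≤ a + b := hy ▸ norm_add_le _ _
  have hinner : -(K * a ^ 2) ≤ α * ⟪v₁ - v₂, p₁ - p₂⟫ := by
    have e1 : ⟪v₁, p₂ - p₁⟫ = -⟪v₁, p₁ - p₂⟫ := by rw [← inner_neg_right, neg_sub]
    rw [e1, norm_sub_rev, ← ha] at hq₁
    rw [inner_sub_left]
    linarith
  have hmono : ‖A (y₁ - y₂)‖ ^ 2 + α * ⟪v₁ - v₂, y₁ - y₂⟫ = ⟪x₁ - x₂, A (y₁ - y₂)⟫ := by
    have e : ⟪A y₁ - x₁, A (y₁ - y₂)⟫ - ⟪A y₂ - x₂, A (y₁ - y₂)⟫ =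
        ‖A (y₁ - y₂)‖ ^ 2 - ⟪x₁ - x₂, A (y₁ - y₂)⟫ := by
      rw [← real_inner_self_eq_norm_sq, ← inner_sub_left, ← inner_sub_left, map_sub]
      congr 1
      abel
    rw [inner_sub_left v₁]
    linarith
  have hrhs : ⟪x₁ - x₂, A (y₁ - y₂)⟫ ≤ ‖x₁ - x₂‖ * (σ * (a + b)) := by
    refine (real_inner_le_norm _ _).trans (mul_le_mul_of_nonneg_left ?_ (norm_nonneg _))
    exact (norm_apply_le_sigmaMax _).trans (mul_le_mul_of_nonneg_left hyab hσ)
  have hsplit : ⟪v₁ - v₂, y₁ - y₂⟫ = ⟪v₁ - v₂, p₁ - p₂⟫ + b ^ 2 := by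
    rw [hy, inner_add_right, real_inner_self_eq_norm_sq]
  have ha0 : 0 ≤ a := norm_nonneg _
  have hb0 : 0 ≤ b := norm_nonneg _
  have hlow : μ ^ 2 / 2 * a ^ 2 - σ ^ 2 * b ^ 2 ≤ ‖A (y₁ - y₂)‖ ^ 2 := by
    have h1 : μ * a ≤ ‖A (y₁ - y₂)‖ + σ * b := by
      refine (hA p₁ hp₁ p₂ hp₂).1.trans ?_
      have e : A p₁ - A p₂ = A (y₁ - y₂) - A (v₁ - v₂) := by
        rw [← map_sub, ← map_sub, hy, add_sub_cancel_right]
      rw [e]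
      exact (norm_sub_le _ _).trans (add_le_add le_rfl (norm_apply_le_sigmaMax _))
    have h2 := pow_le_pow_left₀ (by positivity) h1 2
    nlinarith [sq_nonneg (‖A (y₁ - y₂)‖ - σ * b)]
  have hKa : K * a ^ 2 ≤ μ ^ 2 / 4 * a ^ 2 := noiseFactor_mul_sq_le hμ hμL hA hp₁ hp₂
  have hmain : μ ^ 2 / 4 * a ^ 2 + 1 * b ^ 2 ≤ ‖x₁ - x₂‖ * (σ * (a + b)) := by
    rw [hsplit] at hmono
    have : (σ ^ 2 + 1) * b ^ 2 ≤ α * b ^ 2 :=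
      mul_le_mul_of_nonneg_right (by rw [hα]; linarith) (sq_nonneg _)
    linarith
  have hκ0 : 0 < min (μ ^ 2 / 4) 1 := lt_min (by positivity) one_pos
  rw [div_mul_eq_mul_div, le_div_iff₀ hκ0, mul_comm]
  refine (mul_le_mul_of_nonneg_left hyab hκ0.le).trans ?_
  have h : min (μ ^ 2 / 4) 1 * (a + b) ≤ 2 * (‖x₁ - x₂‖ * σ) :=
    min_mul_add_le (by positivity) one_pos ha0 hb0 (by positivity) (by linarith)
  linarith

end ManifoldInverse

theorem theorem3p3 {n d k : ℕ} (M : Set (EuclideanSpace ℝ (Fin n)))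
    (hcompact : IsCompact M) (hsub : ManifoldInverse.IsC2Submanifold k M)
    (hreach : 0 < ManifoldInverse.reach M)
    (A : EuclideanSpace ℝ (Fin n) →ₗ[ℝ] EuclideanSpace ℝ (Fin d))
    {μ L : ℝ} (hμ : 0 < μ) (hμL : μ ≤ L) (hA : ManifoldInverse.IsBiLipschitzOn A M μ L) :
    ∃ α : ℝ, 0 < α ∧
      (∀ x ∈ ManifoldInverse.admissible A M μ L,
        ∃! y, IsMinOn (ManifoldInverse.objective A M α x) Set.univ y) ∧
      ∀ F : EuclideanSpace ℝ (Fin d) → EuclideanSpace ℝ (Fin n),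
        (∀ x ∈ ManifoldInverse.admissible A M μ L,
          IsMinOn (ManifoldInverse.objective A M α x) Set.univ (F x)) →
        LocallyLipschitzOn (ManifoldInverse.admissible A M μ L) F := by
  obtain ⟨α, hα⟩ : ∃ α, α = ManifoldInverse.sigmaMax A ^ 2 +
    ManifoldInverse.noiseFactor A μ L + 1 := ⟨_, rfl⟩
  have hα0 : 0 < α := by
    have := ManifoldInverse.noiseFactor_nonneg (A := A) (L := L) hμ
    rw [hα]
    positivity
  refine ⟨α, hα0, fun x hx => ?_, fun F hF => ?_⟩
  · obtain ⟨m, hm, -⟩ := id hx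
    obtain ⟨y, hy⟩ := ManifoldInverse.exists_isMinOn_objective hcompact ⟨m, hm⟩ hα0 x (A := A)
    refine ⟨y, hy, fun z hz => ?_⟩
    have h := ManifoldInverse.norm_sub_le_of_isMinOn hcompact hreach hμ hμL hA hα hx hx hz hy
    rw [sub_self, norm_zero, mul_zero] at h
    exact sub_eq_zero.1 (norm_le_zero_iff.1 h)
  · refine fun x _ => ⟨Real.toNNReal (2 * ManifoldInverse.sigmaMax A / min (μ ^ 2 / 4) 1), _,
      self_mem_nhdsWithin, LipschitzOnWith.of_dist_le' fun x₁ hx₁ x₂ hx₂ => ?_⟩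
    rw [dist_eq_norm, dist_eq_norm]
    exact ManifoldInverse.norm_sub_le_of_isMinOn hcompact hreach hμ hμL hA hα hx₁ hx₂
      (hF x₁ hx₁) (hF x₂ hx₂)
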